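/- **Corollary (Convergence of semi-synchronous gradient push for constant step-size).** Let $n\ge 1$, $d\ge 0$, and let $\mathcal G=(\{1,\dots,n\},\mathcal E)$ be a fixed strongly connected directed graph containing all self-loops. Write $N^{\rm out}_i$ for the number of out-neighbours of $i$ (itself included) and $N^{\rm out}_{\max}=\max_i N^{\rm out}_i$. Let $f_i:\mathbb R^d\to\mathbb R$ be differentiable, $\mu_i$-strongly convex ($\mu_i>0$), with $M_i$-Lipschitz gradient; put $\mu=\min_i\mu_i$, $M=\max_i M_i$. Let $x^\star$ be a minimizer of $F=\sum_{i=1}^n f_i$, let $x_i[0]\in\mathbb R^d$ be initial values, and let $\overline\tau^{\rm msg}\in\mathbb N$. *Algorithm (asynchronous gradient push).* Add to each agent $i=(i,0)$ virtual agents $(i,r)$, $1\le r\le\overline\tau^{\rm msg}$. At time-index $k\ge 0$ let $\mathcal A[k]$ be the set of activated agents (with $\mathcal A[0]$ the set of all agents, each agent being activated infinitely often), let $\delta_i[k]=1$ if $i\in\mathcal A[k]$ and $\delta_i[k]=0$ otherwise, and let $\tau_{ji}[k]\in\{0,\dots,\overline\tau^{\rm msg}\}$ be the delay of the message sent by $i\in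 \mathcal A[k]$ to its out-neighbour $j$ at time $k$, with $\tau_{ii}[k]=0$ and $j\in\mathcal A[k+\tau_{ji}[k]]$. The processing delays are bounded by $\overline\tau^{\rm proc}$: if $i\in\mathcal A[k]$, $k\ge1$, then $1\le k-\max\{k'<k: i\in\mathcal A[k']\}\le\overline\tau^{\rm proc}$. Let $\overline P[k]$ be the matrix indexed by the augmented agents with $$\overline P[k]_{(j,r),(i,0)}=\begin{cases}1/N^{\rm out}_i, & i\in\mathcal A[k],\ i\text{ can send to }j,\ \tau_{ji}[k]=r,\\ 1,& i\notin\mathcal A[k],\ r=0,\ j=i,\\ 0,&\text{otherwise,}\end{cases}$$ and, for $s\ge 1$, $\overline P[k]_{(j,r),(i,s)}=1$ if $j=i$ and $r=s-1$, and $0$ otherwise. Starting from $x^{(0)}_i[0]=x_i[0]$, $y^{(0)}_i[0]=1$, and $x^{(r)}_i[0]=0$, $y^{(r)}_i[0]=0$ for $r\ge1$, iterate $$\bm x[k+1]=\overline P[k]\,(\bm x[k]-\bm g[k]),\qquad y[k+1]=\overline P[k]\,y[k],$$ where $\bm g[k]$ has the row $\alpha_i[k]\,\delta_i[k]\,\nabla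 f_i\big(x^{(0)}_i[k]/y^{(0)}_i[k]\big)$ at agent $(i,0)$ and zero rows at the virtual agents. Let $\overline x[k]=\frac1n\sum_{r=0}^{\overline\tau^{\rm msg}}\sum_{i=1}^n x^{(r)}_i[k]$. *Claim.* Suppose $\overline\tau^{\rm proc}=1$, so that all agents update at every step, and let $B>0$. Then there exist finite constants $A_1,A_2,A_3>0$, which may depend on the data above and on $B$, but not on $\theta$, on $K$, or on the schedule (activations and message delays), such that the following holds. For every $\theta\in(0,1)$ and every integer $K\ge1$ such that the constant step-size $\alpha_i[k]=B/K^\theta$ (i.e. $w_iB/K^\theta$ with $w_i=1$) satisfies $$\alpha_i[k]\le\frac{\mu}{2M^2}\Big(\frac1{N^{\rm out}_{\max}}\Big)^{n(\overline\tau+1)}\quad\text{for all } i,k,\qquad \overline\tau=\overline\tau^{\rm msg}+\overline\tau^{\rm proc}-1=\overline\tau^{\rm msg},$$ and for every schedule with the delay bounds $\overline\tau^{\rm msg}$ and $\overline\tau^{\rm proc}=1$, $$\frac1K\sum_{k=0}^{K-1}\|\overline x[k]-x^\star\|^2\le\frac1{K^\theta}\cdot\frac{n(A_1+A_3)}{2\mu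 B}+\frac1K\cdot\frac{nA_2}{2\mu B}+\frac1{K^{1-\theta}}\cdot\frac{n\|\overline x[0]-x^\star\|^2}{2\mu B}.$$ -/

import Mathlib

noncomputable section

namespace AsyncGradientPush

open scoped Classical

/-- The state space `ℝ^d` with its Euclidean norm. -/
abbrev Vec (d : ℕ) : Type := EuclideanSpace ℝ (Fin d)

/-- Agents of the augmented graph: `(i, 0)` is the actual agent `i`, and for `r ≥ 1` the pair
`(i, r)` is the virtual agent that holds the messages to be received by `i` in `r` steps. -/
abbrev AugAgent (n τmsg : ℕ) : Type := Fin n × Fin (τmsg + 1)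

/-- Number of out-neighbours of agent `i` (itself included when `G` has self-loops);
`G.Adj i j` means that `i` can send messages to `j`. -/
def outDegree {n : ℕ} (G : Digraph (Fin n)) (i : Fin n) : ℕ := {j : Fin n | G.Adj i j}.ncard

def maxOutDegree {n : ℕ} (G : Digraph (Fin n)) : ℕ := Finset.univ.sup (outDegree G)

def StronglyConnected {n : ℕ} (G : Digraph (Fin n)) : Prop :=
  ∀ i j : Fin n, Relation.ReflTransGen G.Adj i j

/-- The most recent time-index, strictly before `k`, at which agent `i` was activated
(`0` if there is none). -/
def lastActivation {n : ℕ} (act : ℕ → Set (Fin n)) (i : Fin n) (k : ℕ) : ℕ :=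
  sSup {k' : ℕ | k' < k ∧ i ∈ act k'}

/-- An asynchronous schedule on the communication graph `G`, with processing delays bounded by
`τproc` and message delays bounded by `τmsg`. -/
structure Schedule {n : ℕ} (G : Digraph (Fin n)) (τproc τmsg : ℕ) where
  /-- the set of agents activated at each time-index -/
  act : ℕ → Set (Fin n)
  /-- `delay k j i` is the delay of the message sent by `i` to `j` at time-index `k` -/
  delay : ℕ → Fin n → Fin n → ℕ
  act_zero : ∀ i, i ∈ act 0
  act_infinitely_often : ∀ i k, ∃ k', k < k' ∧ i ∈ act k'
  proc_delay_pos : ∀ i k, 1 ≤ k → i ∈ act k → 1 ≤ k - lastActivation act i k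
  proc_delay_le : ∀ i k, 1 ≤ k → i ∈ act k → k - lastActivation act i k ≤ τproc
  delay_self : ∀ k i, delay k i i = 0
  msg_delay_le : ∀ k i j, i ∈ act k → G.Adj i j → delay k j i ≤ τmsg
  /-- messages are processed at activation times of the receiver -/
  receiver_active : ∀ k i j, i ∈ act k → G.Adj i j → j ∈ act (k + delay k j i)

section Dynamics

variable {n d τproc τmsg : ℕ} {G : Digraph (Fin n)} (S : Schedule G τproc τmsg)

/-- The indicator of agent `i` being activated at time-index `k`. -/
def activity (i : Fin n) (k : ℕ) : ℝ := if i ∈ S.act k then 1 else 0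

/-- The block of the consensus matrix that describes what agent `i` sends to agent `j` with
delay `r` at time-index `k`. -/
def consensusBlock (k r : ℕ) : Matrix (Fin n) (Fin n) ℝ := fun j i =>
  if i ∈ S.act k ∧ G.Adj i j ∧ S.delay k j i = r then 1 / (outDegree G i : ℝ)
  else if i ∉ S.act k ∧ r = 0 ∧ j = i then 1
  else 0

/-- The consensus matrix of the augmented graph. Its first block column holds the blocks
`consensusBlock S k r`; block column `s ≥ 1` has an identity in block row `s - 1`. -/
def consensusMatrix (k : ℕ) : Matrix (AugAgent n τmsg) (AugAgent n τmsg) ℝ := fun p q =>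
  if (q.2 : ℕ) = 0 then consensusBlock S k p.2 p.1 q.1
  else if (q.2 : ℕ) = (p.2 : ℕ) + 1 ∧ p.1 = q.1 then 1
  else 0

/-- The push-sum weights `y[k]`. -/
def weight : ℕ → AugAgent n τmsg → ℝ
  | 0 => fun p => if p.2 = 0 then 1 else 0
  | k + 1 => (consensusMatrix S k).mulVec (weight k)

/-- The push-sum numerators `x[k]` of Asynchronous Gradient-Push, run on the schedule `S` with
local objectives `f`, local step-sizes `α i k` and initial values `x₀`. The gradients are taken
at the de-biased values `z[k] = x[k] / y[k]` of the actual agents. -/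
def numerator (f : Fin n → Vec d → ℝ) (α : Fin n → ℕ → ℝ) (x₀ : Fin n → Vec d) :
    ℕ → AugAgent n τmsg → Vec d
  | 0 => fun p => if p.2 = 0 then x₀ p.1 else 0
  | k + 1 => fun p => ∑ q : AugAgent n τmsg, consensusMatrix S k p q •
      (numerator f α x₀ k q -
        if q.2 = 0 then
          (α q.1 k * activity S q.1 k) •
            gradient (f q.1) ((weight S k q)⁻¹ • numerator f α x₀ k q)
        else 0)

/-- The network average `x̄[k]`: the sum of the numerators of all agents, virtual ones included,
divided by the number `n` of actual agents. -/
def average (f : Fin n → Vec d → ℝ) (α : Fin n → ℕ → ℝ) (x₀ : Fin n → Vec d) (k : ℕ) : Vec d :=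
  (n : ℝ)⁻¹ • ∑ p : AugAgent n τmsg, numerator S f α x₀ k p

end Dynamics

/-- The constant step-sizes `w_i B / K^θ` for a run of `K` steps. -/
def constStepSize {n : ℕ} (w : Fin n → ℝ) (B θ : ℝ) (K : ℕ) : Fin n → ℕ → ℝ :=
  fun i _ => w i * B / (K : ℝ) ^ θ

/-- The upper bound `(μ / (2 M²)) (1 / N_max)^{n (τ + 1)}`, `τ = τmsg + τproc - 1`, on all
step-sizes. -/
def StepSizeBound {n : ℕ} (G : Digraph (Fin n)) (τproc τmsg : ℕ) (μ M : ℝ)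
    (α : Fin n → ℕ → ℝ) : Prop :=
  ∀ i k, α i k ≤
    μ / (2 * M ^ 2) * (1 / (maxOutDegree G : ℝ)) ^ (n * ((τmsg + τproc - 1) + 1))

end AsyncGradientPush

end

/-! With processing delay `1` every agent is always active (`Schedule.mem_act`) and the consensus
matrices are column stochastic. Total mass is then conserved, so the average makes the step `x̄ -
(a/n) ∑ ∇f_i(z_i)` (`average_succ`). If all `z_i` equalled `x̄`, strong convexity would shrink the
distance to the minimizer. The discrepancy is controlled by the `ℓ¹`-norm `u k` of the consensus
error `x - y x̄` (`norm_average_succ_sub_sq_le`).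

Telescoping only needs `∑ u k`. Over `T = n (τmsg + 1)` steps the transition matrix has a row
bounded below by `η = N_max⁻ᵀ` (`le_transition`), so it contracts sum-zero families by `1 - η`,
while the gradients perturb the error by `O(a)`. Hence `∑_{k<K} u k = O(1 + K a)`. Multiplying by
`a` and then dividing by `2 a m K`, where `a = B / K ^ θ`, produces the three rates
(`mean_le_of_const_step`).

All this requires iterates bounded independently of the schedule, which is where the step-size bound
enters. The weights are at least `η` (`le_weight`), so the effective local step `a / y` is at most
`m / (2 M²)`. Such gradient steps preserve a large ball, and nonnegative matrices then preserve the
cone `‖x‖ ≤ L y` (`norm_numerator_le`). -/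

noncomputable section

namespace AsyncGradientPush

/-! ### Strong monotonicity of gradients and invariant balls -/

section Analysis

variable {E : Type*} [NormedAddCommGroup E] [InnerProductSpace ℝ E]

/-- The gradient of a strongly convex function is strongly monotone. -/
theorem strongConvexOn_gradient_inner_ge [CompleteSpace E] {f : E → ℝ} {m : ℝ}
    (hf : StrongConvexOn Set.univ m f) (hd : Differentiable ℝ f) (x y : E) :
    m * ‖x - y‖ ^ 2 ≤ inner ℝ (gradient f x - gradient f y) (x - y) := by
  -- On the line from `y` to `x` the convex function `f - m/2 ‖·‖²` has a monotone derivative; its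
  -- values at `0` and `1` are compared.
  have hc := (strongConvexOn_iff_convex.1 hf).comp_affineMap (AffineMap.lineMap (k := ℝ) y x)
  have hder : ∀ t : ℝ, HasDerivAt
      ((fun z ↦ f z - m / 2 * ‖z‖ ^ 2) ∘ (AffineMap.lineMap (k := ℝ) y x))
      (inner ℝ (gradient f (AffineMap.lineMap y x t)) (x - y)
        - m * inner ℝ (AffineMap.lineMap y x t) (x - y)) t := by
    intro t
    have hl : HasDerivAt (AffineMap.lineMap (k := ℝ) y x) (x - y) t :=
      AffineMap.hasDerivAt_lineMap
    have h1 := (hd (AffineMap.lineMap y x t)).hasGradientAt.hasFDerivAt.comp_hasDerivAt t hl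
    have h2 := (hl.norm_sq).const_mul (m / 2)
    refine (h1.sub h2).congr_deriv ?_
    rw [InnerProductSpace.toDual_apply_apply]
    ring
  have hmono := hc.monotoneOn_deriv (fun t _ ↦ (hder t).differentiableAt)
    (a := 0) (by simp) (b := 1) (by simp) zero_le_one
  rw [(hder 0).deriv, (hder 1).deriv] at hmono
  simp only [AffineMap.lineMap_apply_zero, AffineMap.lineMap_apply_one] at hmono
  have e : ‖x - y‖ ^ 2 = inner ℝ x (x - y) - inner ℝ y (x - y) := by
    rw [← inner_sub_left, real_inner_self_eq_norm_sq]
  rw [inner_sub_left, e]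
  linarith

theorem sum_gradient_eq_zero_of_isMinOn [CompleteSpace E] {ι : Type*} [Fintype ι]
    {f : ι → E → ℝ} (hd : ∀ i, Differentiable ℝ (f i)) {a : E}
    (ha : IsMinOn (fun x ↦ ∑ i, f i x) Set.univ a) : ∑ i, gradient (f i) a = 0 := by
  have h : HasFDerivAt (fun x ↦ ∑ i, f i x)
      (∑ i, InnerProductSpace.toDual ℝ E (gradient (f i) a)) a :=
    HasFDerivAt.fun_sum fun i _ ↦ (hd i a).hasGradientAt.hasFDerivAt
  have h0 := (ha.isLocalMin Filter.univ_mem).hasFDerivAt_eq_zero h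
  rw [← map_sum] at h0
  exact (InnerProductSpace.toDual ℝ E).map_eq_zero_iff.1 h0

/-- Short gradient steps along a strongly monotone field of linear growth preserve a ball. -/
theorem norm_sub_smul_le_of_strongly_monotone {m M C L s : ℝ} (hm : 0 < m) (hM : 0 < M)
    (hL₁ : 2 * C ^ 2 / m + m * C ^ 2 / M ^ 2 ≤ m / 2 * L ^ 2)
    (hL₂ : m / (2 * M ^ 2) * (2 * C ^ 2 / m + m * C ^ 2 / M ^ 2) ≤ L ^ 2) (hL : 0 ≤ L)
    (hs : 0 ≤ s) (hs' : s ≤ m / (2 * M ^ 2)) {v : E → E}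
    (hv : ∀ z, m * ‖z‖ ^ 2 ≤ inner ℝ (v z - v 0) z) (hg : ∀ z, ‖v z‖ ≤ M * ‖z‖ + C)
    {z : E} (hz : ‖z‖ ≤ L) : ‖z - s • v z‖ ≤ L := by
  have h0 : ‖v 0‖ ≤ C := by simpa using hg 0
  have hC : 0 ≤ C := (norm_nonneg _).trans h0
  refine abs_le_of_sq_le_sq' ?_ hL |>.2
  rw [norm_sub_sq_real, inner_smul_right, norm_smul, Real.norm_of_nonneg hs, mul_pow]
  set t := ‖z‖ with ht
  have ht0 : 0 ≤ t := norm_nonneg z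
  have hi : m * t ^ 2 - C * t ≤ inner ℝ z (v z) := by
    have h1 := hv z
    rw [inner_sub_left] at h1
    have h2 : -(‖v 0‖ * ‖z‖) ≤ inner ℝ (v 0) z := neg_le_of_abs_le (abs_real_inner_le_norm _ _)
    have h3 : ‖v 0‖ * ‖z‖ ≤ C * t := mul_le_mul_of_nonneg_right h0 ht0
    rw [real_inner_comm]
    linarith
  have hsq : ‖v z‖ ^ 2 ≤ 2 * M ^ 2 * t ^ 2 + 2 * C ^ 2 := by
    have := pow_le_pow_left₀ (norm_nonneg _) (hg z) 2
    nlinarith [sq_nonneg (M * t - C)]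
  -- The step-size bound is spent on one factor `s`, leaving `s * m * t ^ 2`, half of the gain `2 *
  -- s * m * t ^ 2` from monotonicity. Young's inequality then takes `s * m / 2 * t ^ 2` more.
  have hss : s ^ 2 * ‖v z‖ ^ 2 ≤ s * (m * t ^ 2 + m * C ^ 2 / M ^ 2) := by
    have h1 : s ^ 2 * ‖v z‖ ^ 2 ≤ s * (m / (2 * M ^ 2)) * (2 * M ^ 2 * t ^ 2 + 2 * C ^ 2) := by
      rw [sq s]
      gcongr
    calc _ ≤ _ := h1
      _ = _ := by field_simp
  have hyoung : 2 * C * t ≤ m / 2 * t ^ 2 + 2 * C ^ 2 / m := by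
    have : 0 ≤ (m * t - 2 * C) ^ 2 / (2 * m) := by positivity
    have e : (m * t - 2 * C) ^ 2 / (2 * m) = m / 2 * t ^ 2 + 2 * C ^ 2 / m - 2 * C * t := by
      field_simp; ring
    linarith
  set c := 2 * C ^ 2 / m + m * C ^ 2 / M ^ 2 with hc
  have hc0 : 0 ≤ c := by positivity
  have key : t ^ 2 - 2 * (s * inner ℝ z (v z)) + s ^ 2 * ‖v z‖ ^ 2
      ≤ t ^ 2 * (1 - s * m / 2) + s * c := by
    have h1 := mul_le_mul_of_nonneg_left hi hs
    have h2 := mul_le_mul_of_nonneg_left hyoung hs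
    have e : t ^ 2 * (1 - s * m / 2) + s * c = t ^ 2 - s * (m / 2 * t ^ 2) +
      s * (2 * C ^ 2 / m) + s * (m * C ^ 2 / M ^ 2) := by rw [hc]; ring
    rw [e]
    nlinarith
  refine key.trans ?_
  have ht2 : t ^ 2 ≤ L ^ 2 := pow_le_pow_left₀ ht0 hz 2
  -- No comparison of `m` with `M` is assumed, so the factor `1 - s * m / 2` may be negative; `hL₂`
  -- covers that case.
  rcases le_or_gt (s * m / 2) 1 with h | h
  · have h1 := mul_le_mul_of_nonneg_right ht2 (sub_nonneg.2 h)
    have h2 := mul_le_mul_of_nonneg_left hL₁ hs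
    nlinarith
  · have h1 : t ^ 2 * (1 - s * m / 2) ≤ 0 :=
      mul_nonpos_of_nonneg_of_nonpos (sq_nonneg t) (by linarith)
    have h2 := mul_le_mul_of_nonneg_right hs' hc0
    linarith

end Analysis

/-! ### Column stochastic matrices acting on families of vectors -/

section ColumnStochastic

variable {ι E : Type*} [Fintype ι] [NormedAddCommGroup E] [NormedSpace ℝ E]

/-- The action of a real matrix on a family of vectors. -/
def vecAct (A : Matrix ι ι ℝ) (v : ι → E) : ι → E := fun p ↦ ∑ q, A p q • v q

theorem vecAct_mul (A A' : Matrix ι ι ℝ) (v : ι → E) :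
    vecAct (A * A') v = vecAct A (vecAct A' v) := by
  ext p
  simp only [vecAct, Matrix.mul_apply, Finset.sum_smul, Finset.smul_sum, smul_smul]
  rw [Finset.sum_comm]

theorem vecAct_one [DecidableEq ι] (v : ι → E) : vecAct 1 v = v := by
  ext p
  simp [vecAct, Matrix.one_apply, ite_smul]

theorem vecAct_sub (A : Matrix ι ι ℝ) (v w : ι → E) :
    vecAct A (v - w) = vecAct A v - vecAct A w := by
  ext p
  simp [vecAct, smul_sub]

/-- Nonnegative matrices whose columns sum to `1`. -/
structure IsColumnStochastic (A : Matrix ι ι ℝ) : Prop where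
  nonneg : ∀ p q, 0 ≤ A p q
  sum_col : ∀ q, ∑ p, A p q = 1

theorem IsColumnStochastic.one [DecidableEq ι] :
    IsColumnStochastic (1 : Matrix ι ι ℝ) where
  nonneg p q := by rw [Matrix.one_apply]; split_ifs <;> norm_num
  sum_col q := by simp [Matrix.one_apply]

variable {A A' : Matrix ι ι ℝ}

theorem sum_vecAct_of_sum_col {c : ℝ} (hA : ∀ q, ∑ p, A p q = c) (v : ι → E) :
    ∑ p, vecAct A v p = c • ∑ q, v q := by
  simp only [vecAct]
  rw [Finset.sum_comm, Finset.smul_sum]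
  simp [← Finset.sum_smul, hA]

theorem IsColumnStochastic.mul (hA : IsColumnStochastic A) (hA' : IsColumnStochastic A') :
    IsColumnStochastic (A * A') where
  nonneg p q := Finset.sum_nonneg fun r _ ↦ mul_nonneg (hA.nonneg p r) (hA'.nonneg r q)
  sum_col q := by
    have := sum_vecAct_of_sum_col hA.sum_col (fun r ↦ A' r q)
    simpa [vecAct, hA'.sum_col, Matrix.mul_apply] using this

theorem IsColumnStochastic.sum_vecAct (hA : IsColumnStochastic A) (v : ι → E) :
    ∑ p, vecAct A v p = ∑ q, v q := by
  simpa using sum_vecAct_of_sum_col hA.sum_col v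

theorem sum_norm_vecAct_le {c : ℝ} (h0 : ∀ p q, 0 ≤ A p q) (hA : ∀ q, ∑ p, A p q = c)
    (v : ι → E) : ∑ p, ‖vecAct A v p‖ ≤ c * ∑ q, ‖v q‖ := by
  have : ∑ p, vecAct A (fun q ↦ ‖v q‖) p = c * ∑ q, ‖v q‖ := by
    simpa using sum_vecAct_of_sum_col hA (fun q ↦ ‖v q‖)
  rw [← this]
  refine Finset.sum_le_sum fun p _ ↦ (norm_sum_le _ _).trans (Finset.sum_le_sum fun q _ ↦ ?_)
  rw [norm_smul, Real.norm_of_nonneg (h0 p q), smul_eq_mul]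

theorem IsColumnStochastic.sum_norm_vecAct_le (hA : IsColumnStochastic A) (v : ι → E) :
    ∑ p, ‖vecAct A v p‖ ≤ ∑ q, ‖v q‖ := by
  simpa using AsyncGradientPush.sum_norm_vecAct_le hA.nonneg hA.sum_col v

/-- A column stochastic matrix with a row bounded below by `η` contracts families of sum zero
by the factor `1 - η` in the `ℓ¹`-norm. -/
theorem IsColumnStochastic.sum_norm_vecAct_le_of_row [DecidableEq ι]
    (hA : IsColumnStochastic A) {η : ℝ} {p₀ : ι} (hrow : ∀ q, η ≤ A p₀ q) {v : ι → E}
    (hv : ∑ q, v q = 0) : ∑ p, ‖vecAct A v p‖ ≤ (1 - η) * ∑ q, ‖v q‖ := by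
  -- Subtracting `η` from row `p₀` does not change the action on sum-zero families; the entries stay
  -- nonnegative and the column sums drop to `1 - η`.
  set D : Matrix ι ι ℝ := fun p q ↦ A p q - if p = p₀ then η else 0 with hD
  have e : vecAct A v = vecAct D v := by
    ext p
    simp only [vecAct, hD, sub_smul, Finset.sum_sub_distrib, ← Finset.smul_sum, hv, smul_zero,
      sub_zero]
  rw [e]
  refine AsyncGradientPush.sum_norm_vecAct_le (fun p q ↦ ?_) (fun q ↦ ?_) v
  · by_cases h : p = p₀
    · simpa [hD, h] using hrow q
    · simpa [hD, h] using hA.nonneg p q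
  · simp [hD, Finset.sum_sub_distrib, hA.sum_col]

end ColumnStochastic

/-! ### Walks of fixed length in the communication graph -/

section Walks

variable {n : ℕ} (G : Digraph (Fin n))

/-- The vertices reached from `i` by walks with exactly `m` edges. -/
def walkEnds (i : Fin n) : ℕ → Set (Fin n)
  | 0 => {i}
  | m + 1 => {j | ∃ l ∈ walkEnds i m, G.Adj l j}

variable {G}

/-- Self-loops make the sets increase with the length. A step that adds nothing yields a set closed
under edges, which is everything by strong connectivity; every earlier step adds a vertex. -/
theorem walkEnds_eq_univ (hself : ∀ i, G.Adj i i) (hconn : StronglyConnected G) (i : Fin n) :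
    walkEnds G i (n - 1) = Set.univ := by
  have hmono : ∀ m, walkEnds G i m ⊆ walkEnds G i (m + 1) := fun m j hj ↦ ⟨j, hj, hself j⟩
  have hi : ∀ m, i ∈ walkEnds G i m := fun m ↦ by
    induction m with
    | zero => exact rfl
    | succ m ih => exact hmono m ih
  have hclosed : ∀ m, walkEnds G i (m + 1) = walkEnds G i m → walkEnds G i m = Set.univ := by
    intro m hm
    refine Set.eq_univ_of_forall fun j ↦ ?_
    induction hconn i j with
    | refl => exact hi m
    | tail _ hadj ih => rw [← hm]; exact ⟨_, ih, hadj⟩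
  have hcard : ∀ m, walkEnds G i m = Set.univ ∨ m + 1 ≤ (walkEnds G i m).ncard := by
    intro m
    induction m with
    | zero => right; simp [walkEnds]
    | succ m ih =>
      by_cases hm : walkEnds G i (m + 1) = walkEnds G i m
      · left; rw [hm]; exact hclosed m hm
      · right
        rcases ih with ih | ih
        · exact absurd (Set.Subset.antisymm (by rw [ih]; exact Set.subset_univ _) (hmono m)) hm
        · have := Set.ncard_lt_ncard ((hmono m).ssubset_of_ne (Ne.symm hm)) (Set.toFinite _)
          omega
  rcases hcard (n - 1) with h | h
  · exact h
  · refine (Set.eq_of_subset_of_ncard_le (Set.subset_univ _) ?_ (Set.toFinite _))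
    rw [Set.ncard_univ, Nat.card_eq_fintype_card, Fintype.card_fin]
    omega

end Walks

open scoped Classical

theorem outDegree_pos {n : ℕ} {G : Digraph (Fin n)} (hself : ∀ i, G.Adj i i) (i : Fin n) :
    0 < outDegree G i :=
  (Set.ncard_pos (Set.toFinite _)).2 ⟨i, hself i⟩

theorem outDegree_le_maxOutDegree {n : ℕ} (G : Digraph (Fin n)) (i : Fin n) :
    outDegree G i ≤ maxOutDegree G :=
  Finset.le_sup (f := outDegree G) (Finset.mem_univ i)

/-! ### Positivity of transition matrices and of push-sum weights -/

section

variable {n d τmsg : ℕ} {G : Digraph (Fin n)} (S : Schedule G 1 τmsg)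

/-- If the processing delays are bounded by `1`, then all agents are always active. -/
theorem Schedule.mem_act (i : Fin n) (k : ℕ) : i ∈ S.act k := by
  by_contra hk
  -- If `i` is inactive at `k`, the first activation after `k` and the last one before `k` are at
  -- least `2` apart.
  have hex := S.act_infinitely_often i k
  obtain ⟨hlt, hmem⟩ := Nat.find_spec hex
  set k' := Nat.find hex with hk'
  have h1 := S.proc_delay_le i k' (by omega) hmem
  have hlast : lastActivation S.act i k' < k := by
    have hin := Nat.sSup_mem (s := {j : ℕ | j < k' ∧ i ∈ S.act j}) ⟨0, by omega, S.act_zero i⟩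
      ⟨k', fun j hj ↦ hj.1.le⟩
    change lastActivation S.act i k' < k' ∧ i ∈ S.act (lastActivation S.act i k') at hin
    by_contra hge
    rcases (not_lt.1 hge).eq_or_lt with h | h
    · rw [h] at hk; exact hk hin.2
    · exact Nat.find_min hex hin.1 ⟨h, hin.2⟩
  omega

theorem activity_eq_one (i : Fin n) (k : ℕ) : activity S i k = 1 := if_pos (S.mem_act i k)

theorem consensusBlock_eq (k r : ℕ) (j i : Fin n) : consensusBlock S k r j i =
    if G.Adj i j ∧ S.delay k j i = r then 1 / (outDegree G i : ℝ) else 0 := by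
  simp [consensusBlock, S.mem_act]

/-- An actual agent sends `1 / outDegree` to each out-neighbour in exactly one delay slot, which
exists by the delay bound. A virtual agent passes all its mass one slot down. -/
theorem isColumnStochastic_consensusMatrix (hself : ∀ i, G.Adj i i) (k : ℕ) :
    IsColumnStochastic (consensusMatrix S k) where
  nonneg p q := by
    simp only [consensusMatrix, consensusBlock_eq]
    split_ifs <;> positivity
  sum_col := by
    rintro ⟨i, s⟩
    simp only [consensusMatrix, consensusBlock_eq]
    by_cases hs : (s : ℕ) = 0
    · simp only [hs, if_true, Fintype.sum_prod_type]
      have hrow : ∀ j, ∑ r : Fin (τmsg + 1),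
          (if G.Adj i j ∧ S.delay k j i = (r : ℕ) then 1 / (outDegree G i : ℝ) else 0)
          = if G.Adj i j then 1 / (outDegree G i : ℝ) else 0 := by
        intro j
        by_cases hadj : G.Adj i j
        · have hd := S.msg_delay_le k i j (S.mem_act i k) hadj
          rw [Finset.sum_eq_single ⟨S.delay k j i, by omega⟩]
          · simp
          · intro r _ hr
            rw [if_neg]
            rintro ⟨-, h⟩
            exact hr (Fin.ext h.symm)
          · simp
        · simp [hadj]
      rw [Finset.sum_congr rfl fun j _ ↦ hrow j, Finset.sum_ite, Finset.sum_const_zero, add_zero,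
        Finset.sum_const, nsmul_eq_mul]
      have hc : (Finset.univ.filter fun j ↦ G.Adj i j).card = outDegree G i := by
        rw [outDegree, ← Set.ncard_coe_finset]
        simp
      have := outDegree_pos hself i
      rw [hc]
      field_simp
    · simp only [hs, if_false]
      have hs' := s.isLt
      rw [Finset.sum_eq_single (i, ⟨s - 1, by omega⟩)]
      · rw [if_pos]
        exact ⟨by simp only; omega, rfl⟩
      · rintro ⟨j, r⟩ _ hne
        rw [if_neg]
        rintro ⟨h1, h2⟩
        refine hne (Prod.ext h2 (Fin.ext ?_))
        simp only at h1 ⊢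
        omega
      · simp

/-- The product `P[k + t - 1] ⋯ P[k]` of consensus matrices. -/
def transition (k : ℕ) : ℕ → Matrix (AugAgent n τmsg) (AugAgent n τmsg) ℝ
  | 0 => 1
  | t + 1 => consensusMatrix S (k + t) * transition k t

theorem isColumnStochastic_transition (hself : ∀ i, G.Adj i i) (k t : ℕ) :
    IsColumnStochastic (transition S k t) := by
  induction t with
  | zero => exact .one
  | succ t ih => exact (isColumnStochastic_consensusMatrix S hself _).mul ih

theorem weight_succ (k : ℕ) : weight S (k + 1) = vecAct (consensusMatrix S k) (weight S k) := by
  ext p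
  simp [weight, vecAct, Matrix.mulVec, dotProduct]

theorem weight_add (k t : ℕ) : weight S (k + t) = vecAct (transition S k t) (weight S k) := by
  induction t with
  | zero => rw [transition, vecAct_one, add_zero]
  | succ t ih => rw [← add_assoc, weight_succ, transition, vecAct_mul, ih]

theorem weight_nonneg (hself : ∀ i, G.Adj i i) (k : ℕ) (p : AugAgent n τmsg) :
    0 ≤ weight S k p := by
  induction k generalizing p with
  | zero => simp only [weight]; split_ifs <;> norm_num
  | succ k ih =>
    rw [weight_succ]
    exact Finset.sum_nonneg fun q _ ↦
      mul_nonneg ((isColumnStochastic_consensusMatrix S hself k).nonneg p q) (ih q)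

theorem sum_augAgent_ite {E : Type*} [AddCommMonoid E] (v : Fin n → E) :
    (∑ p : AugAgent n τmsg, if p.2 = 0 then v p.1 else 0) = ∑ i, v i := by
  rw [Fintype.sum_prod_type]
  simp

theorem sum_weight (hself : ∀ i, G.Adj i i) (k : ℕ) : ∑ p, weight S k p = n := by
  induction k with
  | zero =>
    have := sum_augAgent_ite (τmsg := τmsg) (fun _ : Fin n ↦ (1 : ℝ))
    simpa [weight] using this
  | succ k ih =>
    rw [weight_succ, (isColumnStochastic_consensusMatrix S hself k).sum_vecAct, ih]

variable {S} {k t : ℕ} {q : AugAgent n τmsg}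

theorem transition_step (hself : ∀ i, G.Adj i i) {ε : ℝ} (hε : 0 ≤ ε) {p p' : AugAgent n τmsg}
    (h : ε ^ t ≤ transition S k t p q) (hstep : ε ≤ consensusMatrix S (k + t) p' p) :
    ε ^ (t + 1) ≤ transition S k (t + 1) p' q := by
  have h0 := isColumnStochastic_consensusMatrix S hself (k + t)
  have h1 := isColumnStochastic_transition S hself k t
  rw [transition, Matrix.mul_apply, pow_succ']
  refine (mul_le_mul hstep h (pow_nonneg hε t) (h0.nonneg _ _)).trans ?_
  exact Finset.single_le_sum
    (f := fun r ↦ consensusMatrix S (k + t) p' r * transition S k t r q)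
    (fun r _ ↦ mul_nonneg (h0.nonneg _ _) (h1.nonneg _ _)) (Finset.mem_univ p)

variable (hself : ∀ i, G.Adj i i)
include hself

theorem maxOutDegree_pos (hn : 0 < n) : 0 < maxOutDegree G :=
  (outDegree_pos hself ⟨0, hn⟩).trans_le (outDegree_le_maxOutDegree G _)

theorem le_consensusMatrix_of_adj {i j : Fin n} (hadj : G.Adj i j) {r : Fin (τmsg + 1)}
    (hr : S.delay k j i = r) :
    1 / (maxOutDegree G : ℝ) ≤ consensusMatrix S k (j, r) (i, 0) := by
  have h1 := outDegree_pos hself i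
  have h2 := outDegree_le_maxOutDegree G i
  simp only [consensusMatrix, consensusBlock_eq, Fin.val_zero, if_true, hadj, hr, true_and]
  gcongr

/-- A message in slot `r` drains to the actual agent in `r` steps, along entries equal to `1`. -/
theorem transition_shift {j : Fin n} (r : ℕ) (hr : r < τmsg + 1) {t : ℕ}
    (h : (1 / (maxOutDegree G : ℝ)) ^ t ≤ transition S k t (j, ⟨r, hr⟩) q) :
    (1 / (maxOutDegree G : ℝ)) ^ (t + r) ≤ transition S k (t + r) (j, 0) q := by
  induction r generalizing t with
  | zero => exact h
  | succ r ih =>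
    have hpos := maxOutDegree_pos hself j.pos
    have : 1 / (maxOutDegree G : ℝ) ≤ 1 := by
      rw [div_le_one (by positivity)]
      exact_mod_cast hpos
    have h1 := ih (by omega) (transition_step hself (by positivity)
      (p' := (j, ⟨r, by omega⟩)) h (by simpa [consensusMatrix] using this))
    rwa [add_assoc, add_comm 1 r] at h1

/-- Self-messages have no delay, so mass can wait at an actual agent; this pads paths to a
prescribed length. -/
theorem transition_self {j : Fin n} (m : ℕ)
    (h : (1 / (maxOutDegree G : ℝ)) ^ t ≤ transition S k t (j, 0) q) :
    (1 / (maxOutDegree G : ℝ)) ^ (t + m) ≤ transition S k (t + m) (j, 0) q := by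
  induction m with
  | zero => exact h
  | succ m ih =>
    exact transition_step hself (by positivity) ih
      (le_consensusMatrix_of_adj hself (hself j) (S.delay_self _ j))

/-- One step sends, the delay drains, and waiting fills the rest, so crossing an edge takes `τmsg +
1` steps whatever the delay. -/
theorem transition_edge {i j : Fin n} (hadj : G.Adj i j)
    (h : (1 / (maxOutDegree G : ℝ)) ^ t ≤ transition S k t (i, 0) q) :
    (1 / (maxOutDegree G : ℝ)) ^ (t + (τmsg + 1)) ≤
      transition S k (t + (τmsg + 1)) (j, 0) q := by
  have hd := S.msg_delay_le (k + t) i j (S.mem_act _ _) hadj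
  have h1 := transition_step hself (by positivity) h
    (le_consensusMatrix_of_adj hself hadj (r := ⟨S.delay (k + t) j i, by omega⟩) rfl)
  have h2 := transition_self hself (τmsg - S.delay (k + t) j i) (transition_shift hself _ _ h1)
  have e : t + 1 + S.delay (k + t) j i + (τmsg - S.delay (k + t) j i) = t + (τmsg + 1) := by omega
  rwa [e] at h2

theorem transition_walk {i j : Fin n} {m : ℕ} (hj : j ∈ walkEnds G i m)
    (h : (1 / (maxOutDegree G : ℝ)) ^ t ≤ transition S k t (i, 0) q) :
    (1 / (maxOutDegree G : ℝ)) ^ (t + m * (τmsg + 1)) ≤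
      transition S k (t + m * (τmsg + 1)) (j, 0) q := by
  induction m generalizing j with
  | zero =>
    obtain rfl : j = i := hj
    simpa using h
  | succ m ih =>
    obtain ⟨l, hl, hadj⟩ := hj
    have := transition_edge hself hadj (ih hl)
    rwa [add_assoc, ← Nat.succ_mul] at this

/-- Over a window of `n (τ + 1)` steps, every agent of the augmented graph influences every
actual agent. -/
theorem le_transition (hconn : StronglyConnected G) (k : ℕ) (j : Fin n) (q : AugAgent n τmsg) :
    (1 / (maxOutDegree G : ℝ)) ^ (n * (τmsg + 1)) ≤
      transition S k (n * (τmsg + 1)) (j, 0) q := by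
  obtain ⟨i, r⟩ := q
  have h0 : (1 / (maxOutDegree G : ℝ)) ^ 0 ≤ transition S k 0 (i, ⟨r, r.isLt⟩) (i, r) := by
    simp [transition]
  have hj : j ∈ walkEnds G i (n - 1) := by rw [walkEnds_eq_univ hself hconn]; trivial
  have h1 := transition_self hself (τmsg + 1 - r)
    (transition_walk hself hj (transition_shift hself _ _ h0))
  have e : 0 + (r : ℕ) + (n - 1) * (τmsg + 1) + (τmsg + 1 - r) = n * (τmsg + 1) := by
    obtain ⟨m, rfl⟩ : ∃ m, n = m + 1 := ⟨n - 1, by have := i.pos; omega⟩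
    have := r.isLt
    rw [Nat.add_sub_cancel, Nat.succ_mul]
    omega
  rwa [e] at h1

-- After a full window, the row bound is applied to the total mass `n ≥ 1`. Earlier, the initial
-- weight `1` retained through self-loops suffices.
variable (S) in
theorem le_weight (hconn : StronglyConnected G) (k : ℕ) (i : Fin n) :
    (1 / (maxOutDegree G : ℝ)) ^ (n * (τmsg + 1)) ≤ weight S k (i, 0) := by
  have hpos := maxOutDegree_pos hself i.pos
  set T := n * (τmsg + 1)
  rcases le_total T k with hk | hk
  · obtain ⟨k', rfl⟩ := Nat.exists_eq_add_of_le' hk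
    rw [weight_add, vecAct]
    calc (1 / (maxOutDegree G : ℝ)) ^ T ≤ (1 / (maxOutDegree G : ℝ)) ^ T * n :=
          le_mul_of_one_le_right (by positivity) (by exact_mod_cast i.pos)
      _ = ∑ q, (1 / (maxOutDegree G : ℝ)) ^ T * weight S k' q := by
          rw [← Finset.mul_sum, sum_weight S hself]
      _ ≤ _ := Finset.sum_le_sum fun q _ ↦ mul_le_mul_of_nonneg_right
          (le_transition hself hconn k' i q) (weight_nonneg S hself k' q)
  · have h0 : (1 / (maxOutDegree G : ℝ)) ^ 0 ≤ transition S 0 0 (i, 0) (i, 0) := by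
      simp [transition]
    have h1 := transition_self hself k h0
    rw [zero_add] at h1
    have h2 := weight_add S 0 k
    rw [zero_add] at h2
    rw [h2]
    have hle : (1 / (maxOutDegree G : ℝ)) ^ T ≤ (1 / (maxOutDegree G : ℝ)) ^ k := by
      refine pow_le_pow_of_le_one (by positivity) ?_ hk
      rw [div_le_one (by positivity)]
      exact_mod_cast hpos
    refine (hle.trans h1).trans ?_
    have := Finset.single_le_sum (f := fun q ↦ transition S 0 k (i, 0) q * weight S 0 q)
      (fun q _ ↦ mul_nonneg ((isColumnStochastic_transition S hself 0 k).nonneg _ _)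
        (weight_nonneg S hself 0 q)) (Finset.mem_univ ((i, 0) : AugAgent n τmsg))
    simpa [weight, vecAct] using this

end

/-- Summing the hypothesis over `k < K` compares the sum with its shift by `T`, and the two differ
by at most the first `T` terms. No geometric decay of individual terms is needed. -/
theorem mul_sum_range_le_of_window_contraction {u : ℕ → ℝ} (hu : ∀ k, 0 ≤ u k) {T : ℕ} {η c : ℝ}
    (h : ∀ k, u (k + T) ≤ (1 - η) * u k + c) (K : ℕ) :
    η * ∑ k ∈ Finset.range K, u k ≤ ∑ k ∈ Finset.range T, u k + K * c := by
  have h1 : ∑ k ∈ Finset.range K, u k ≤ ∑ k ∈ Finset.range (T + K), u k :=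
    Finset.sum_le_sum_of_subset_of_nonneg (Finset.range_mono (Nat.le_add_left K T))
      fun k _ _ ↦ hu k
  have h2 : ∑ k ∈ Finset.range K, u (T + k) ≤
      (1 - η) * ∑ k ∈ Finset.range K, u k + K * c := by
    calc _ ≤ ∑ k ∈ Finset.range K, ((1 - η) * u k + c) :=
          Finset.sum_le_sum fun k _ ↦ by rw [add_comm]; exact h k
      _ = _ := by simp [Finset.sum_add_distrib, Finset.mul_sum]
  rw [Finset.sum_range_add] at h1
  linarith

/-! ### Boundedness of the iterates and the consensus error -/

section

variable {n d τmsg : ℕ} {G : Digraph (Fin n)} (S : Schedule G 1 τmsg)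
  (f : Fin n → Vec d → ℝ) (α : Fin n → ℕ → ℝ) (x₀ : Fin n → Vec d)

/-- The de-biased value `x[k] / y[k]`. -/
def debiased (k : ℕ) (p : AugAgent n τmsg) : Vec d :=
  (weight S k p)⁻¹ • numerator S f α x₀ k p

/-- The gradient steps made at time-index `k`; they vanish at virtual agents. -/
def gradStep (k : ℕ) (p : AugAgent n τmsg) : Vec d :=
  if p.2 = 0 then α p.1 k • gradient (f p.1) (debiased S f α x₀ k p) else 0

theorem numerator_succ (k : ℕ) : numerator S f α x₀ (k + 1) =
    vecAct (consensusMatrix S k) (numerator S f α x₀ k - gradStep S f α x₀ k) := by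
  ext1 p
  simp only [numerator, vecAct, gradStep, debiased, activity_eq_one, mul_one, Pi.sub_apply]

theorem sum_numerator (hn : 0 < n) (k : ℕ) :
    ∑ p, numerator S f α x₀ k p = (n : ℝ) • average S f α x₀ k := by
  rw [average, smul_inv_smul₀ (by positivity)]

variable (hself : ∀ i, G.Adj i i)
include hself

theorem average_succ (k : ℕ) : average S f α x₀ (k + 1) =
    average S f α x₀ k - (n : ℝ)⁻¹ • ∑ p, gradStep S f α x₀ k p := by
  rw [average, numerator_succ, (isColumnStochastic_consensusMatrix S hself k).sum_vecAct, average,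
    ← smul_sub, ← Finset.sum_sub_distrib]
  rfl

omit hself in
theorem sum_norm_gradStep_le {a Γ : ℝ} (ha : 0 ≤ a) {k : ℕ} (hα : ∀ i, α i k = a)
    (hΓ : ∀ i, ‖gradient (f i) (debiased S f α x₀ k (i, 0))‖ ≤ Γ) :
    ∑ p, ‖gradStep S f α x₀ k p‖ ≤ n * (a * Γ) := by
  have h : ∀ p : AugAgent n τmsg, ‖gradStep S f α x₀ k p‖ ≤ if p.2 = 0 then a * Γ else 0 := by
    rintro ⟨i, r⟩
    simp only [gradStep]
    split_ifs with hr
    · subst hr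
      rw [norm_smul, hα, Real.norm_of_nonneg ha]
      exact mul_le_mul_of_nonneg_left (hΓ i) ha
    · simp
  refine (Finset.sum_le_sum fun p _ ↦ h p).trans_eq ?_
  rw [sum_augAgent_ite fun _ : Fin n ↦ a * Γ]
  simp

/-- The numerators stay in the cone `‖x‖ ≤ L y` if every local gradient step, with the step-size
amplified by the inverse of the smallest weight `η`, preserves the ball of radius `L`. -/
theorem norm_numerator_le {η L b : ℝ} (hη : 0 < η) (hy : ∀ k i, η ≤ weight S k (i, 0))
    (hα : ∀ i k, 0 ≤ α i k) (hα' : ∀ i k, α i k ≤ b * η)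
    (hstep : ∀ i s z, 0 ≤ s → s ≤ b → ‖z‖ ≤ L → ‖z - s • gradient (f i) z‖ ≤ L)
    (hx₀ : ∀ i, ‖x₀ i‖ ≤ L) (k : ℕ) (p : AugAgent n τmsg) :
    ‖numerator S f α x₀ k p‖ ≤ L * weight S k p := by
  induction k generalizing p with
  | zero =>
    simp only [numerator, weight]
    split_ifs
    · simpa using hx₀ p.1
    · simp
  | succ k ih =>
    have hq : ∀ q, ‖(numerator S f α x₀ k - gradStep S f α x₀ k) q‖ ≤ L * weight S k q := by
      rintro ⟨i, r⟩
      by_cases hr : r = 0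
      · subst hr
        have hpos := hη.trans_le (hy k i)
        set y := weight S k (i, 0) with hy'
        have hz : ‖debiased S f α x₀ k (i, 0)‖ ≤ L := by
          rw [debiased, norm_smul, norm_inv, ← hy', Real.norm_of_nonneg hpos.le,
            inv_mul_le_iff₀ hpos, mul_comm]
          exact ih (i, 0)
        have hs : α i k / y ≤ b := by
          have hb : 0 ≤ b := by
            have := (hα i k).trans (hα' i k)
            exact nonneg_of_mul_nonneg_left this hη
          rw [div_le_iff₀ hpos]
          exact (hα' i k).trans (mul_le_mul_of_nonneg_left (hy k i) hb)
        -- In de-biased coordinates this is a gradient step of size `α / y`, hence the amplification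
        -- by `1 / η`.
        have e : (numerator S f α x₀ k - gradStep S f α x₀ k) (i, 0) =
            y • (debiased S f α x₀ k (i, 0) -
              (α i k / y) • gradient (f i) (debiased S f α x₀ k (i, 0))) := by
          rw [smul_sub, smul_smul, mul_div_cancel₀ _ hpos.ne', Pi.sub_apply]
          congr 1
          rw [debiased, smul_inv_smul₀ hpos.ne']
        rw [e, norm_smul, Real.norm_of_nonneg hpos.le, mul_comm]
        exact mul_le_mul_of_nonneg_right
          (hstep i _ _ (div_nonneg (hα i k) hpos.le) hs hz) hpos.le
      · simpa [gradStep, hr] using ih (i, r)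
    rw [numerator_succ, weight_succ, vecAct, vecAct, Finset.mul_sum]
    refine (norm_sum_le _ _).trans (Finset.sum_le_sum fun q _ ↦ ?_)
    have h0 := (isColumnStochastic_consensusMatrix S hself k).nonneg p q
    rw [norm_smul, Real.norm_of_nonneg h0, smul_eq_mul, mul_left_comm]
    exact mul_le_mul_of_nonneg_left (hq q) h0

omit hself in
theorem norm_debiased_le {L : ℝ} {k : ℕ} {p : AugAgent n τmsg} (hpos : 0 < weight S k p)
    (h : ‖numerator S f α x₀ k p‖ ≤ L * weight S k p) : ‖debiased S f α x₀ k p‖ ≤ L := by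
  rwa [debiased, norm_smul, norm_inv, Real.norm_of_nonneg hpos.le, inv_mul_le_iff₀ hpos, mul_comm]

theorem sum_norm_numerator_le {L : ℝ} {k : ℕ}
    (h : ∀ p, ‖numerator S f α x₀ k p‖ ≤ L * weight S k p) :
    ∑ p, ‖numerator S f α x₀ k p‖ ≤ n * L := by
  refine (Finset.sum_le_sum fun p _ ↦ h p).trans_eq ?_
  rw [← Finset.mul_sum, sum_weight S hself, mul_comm]

theorem norm_average_le (hn : 0 < n) {L : ℝ} {k : ℕ}
    (h : ∀ p, ‖numerator S f α x₀ k p‖ ≤ L * weight S k p) : ‖average S f α x₀ k‖ ≤ L := by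
  have hn' : (0 : ℝ) < n := by exact_mod_cast hn
  rw [average, norm_smul, norm_inv, Real.norm_of_nonneg hn'.le, inv_mul_le_iff₀ hn']
  exact (norm_sum_le _ _).trans (sum_norm_numerator_le S f α x₀ hself h)

/-- The deviation of the numerators from the network average, weighted by `y[k]`. -/
def consensusError (k : ℕ) (p : AugAgent n τmsg) : Vec d :=
  numerator S f α x₀ k p - weight S k p • average S f α x₀ k

/-- The deviation of the gradient steps from their network average, weighted by `y[k]`. -/
def gradStepError (k : ℕ) (p : AugAgent n τmsg) : Vec d :=
  gradStep S f α x₀ k p - weight S k p • ((n : ℝ)⁻¹ • ∑ q, gradStep S f α x₀ k q)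

theorem sum_consensusError (hn : 0 < n) (k : ℕ) : ∑ p, consensusError S f α x₀ k p = 0 := by
  simp only [consensusError]
  rw [Finset.sum_sub_distrib, ← Finset.sum_smul, sum_weight S hself, sum_numerator _ _ _ _ hn,
    sub_self]

/-- Weights and numerators are driven by the same matrix, so subtracting `y x̄` keeps the recursion
linear. -/
theorem consensusError_succ (k : ℕ) : consensusError S f α x₀ (k + 1) =
    vecAct (consensusMatrix S k) (consensusError S f α x₀ k - gradStepError S f α x₀ k) := by
  ext1 p
  rw [consensusError, numerator_succ, weight_succ, average_succ S f α x₀ hself]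
  simp only [vecAct, consensusError, gradStepError, Finset.sum_smul, Pi.sub_apply, smul_eq_mul,
    mul_smul]
  rw [← Finset.sum_sub_distrib]
  refine Finset.sum_congr rfl fun q _ ↦ ?_
  simp only [smul_sub]
  abel

/-- This crude bound serves for the first window, before any contraction is available. -/
theorem sum_norm_consensusError_le (hn : 0 < n) {L : ℝ} {k : ℕ}
    (h : ∀ p, ‖numerator S f α x₀ k p‖ ≤ L * weight S k p) :
    ∑ p, ‖consensusError S f α x₀ k p‖ ≤ 2 * n * L := by
  calc ∑ p, ‖consensusError S f α x₀ k p‖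
      ≤ ∑ p, (‖numerator S f α x₀ k p‖ + weight S k p * L) := by
        refine Finset.sum_le_sum fun p _ ↦ (norm_sub_le _ _).trans ?_
        rw [norm_smul, Real.norm_of_nonneg (weight_nonneg S hself k p)]
        gcongr
        · exact weight_nonneg S hself k p
        · exact norm_average_le S f α x₀ hself hn h
    _ ≤ n * L + n * L := by
        rw [Finset.sum_add_distrib, ← Finset.sum_mul, sum_weight S hself]
        gcongr
        exact sum_norm_numerator_le S f α x₀ hself h
    _ = 2 * n * L := by ring

theorem sum_norm_gradStepError_le (hn : 0 < n) (k : ℕ) :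
    ∑ p, ‖gradStepError S f α x₀ k p‖ ≤ 2 * ∑ p, ‖gradStep S f α x₀ k p‖ := by
  have hn' : (0 : ℝ) < n := by exact_mod_cast hn
  calc ∑ p, ‖gradStepError S f α x₀ k p‖
      ≤ ∑ p, (‖gradStep S f α x₀ k p‖ +
          weight S k p * ((n : ℝ)⁻¹ * ∑ q, ‖gradStep S f α x₀ k q‖)) := by
        refine Finset.sum_le_sum fun p _ ↦ (norm_sub_le _ _).trans ?_
        rw [norm_smul, norm_smul, Real.norm_of_nonneg (weight_nonneg S hself k p), norm_inv,
          Real.norm_of_nonneg hn'.le]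
        gcongr
        · exact weight_nonneg S hself k p
        · exact norm_sum_le _ _
    _ = 2 * ∑ p, ‖gradStep S f α x₀ k p‖ := by
        rw [Finset.sum_add_distrib, ← Finset.sum_mul, sum_weight S hself]
        field_simp
        ring

/-- Unrolling the recursion, each step adds a perturbation of size at most `H`, and column
stochastic matrices do not expand the `ℓ¹`-norm. -/
theorem sum_norm_consensusError_sub_le {H : ℝ}
    (hH : ∀ k, ∑ p, ‖gradStepError S f α x₀ k p‖ ≤ H) (k t : ℕ) :
    ∑ p, ‖(consensusError S f α x₀ (k + t) -
      vecAct (transition S k t) (consensusError S f α x₀ k)) p‖ ≤ t * H := by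
  induction t with
  | zero => simp [transition, vecAct_one]
  | succ t ih =>
    have hP := isColumnStochastic_consensusMatrix S hself (k + t)
    have e : consensusError S f α x₀ (k + (t + 1)) -
        vecAct (transition S k (t + 1)) (consensusError S f α x₀ k) =
        vecAct (consensusMatrix S (k + t)) ((consensusError S f α x₀ (k + t) -
          vecAct (transition S k t) (consensusError S f α x₀ k)) -
          gradStepError S f α x₀ (k + t)) := by
      rw [← add_assoc, consensusError_succ S f α x₀ hself, transition, vecAct_mul, ← vecAct_sub,
        sub_right_comm]
    rw [e]
    refine (hP.sum_norm_vecAct_le _).trans ?_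
    refine (Finset.sum_le_sum fun p _ ↦ norm_sub_le _ _).trans ?_
    rw [Finset.sum_add_distrib]
    push_cast
    linarith [hH (k + t)]

theorem sum_norm_consensusError_add_le (hconn : StronglyConnected G) (hn : 0 < n) {H : ℝ}
    (hH : ∀ k, ∑ p, ‖gradStepError S f α x₀ k p‖ ≤ H) (k : ℕ) :
    ∑ p, ‖consensusError S f α x₀ (k + n * (τmsg + 1)) p‖ ≤
      (1 - (1 / (maxOutDegree G : ℝ)) ^ (n * (τmsg + 1))) *
        ∑ p, ‖consensusError S f α x₀ k p‖ + (n * (τmsg + 1) : ℕ) * H := by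
  set T := n * (τmsg + 1)
  have h1 := sum_norm_consensusError_sub_le S f α x₀ hself hH k T
  have h2 := (isColumnStochastic_transition S hself k T).sum_norm_vecAct_le_of_row
    (le_transition hself hconn k ⟨0, hn⟩) (sum_consensusError S f α x₀ hself hn k)
  have h3 : ∑ p, ‖consensusError S f α x₀ (k + T) p‖ ≤
      ∑ p, (‖(consensusError S f α x₀ (k + T) -
        vecAct (transition S k T) (consensusError S f α x₀ k)) p‖ +
        ‖vecAct (transition S k T) (consensusError S f α x₀ k) p‖) :=
    Finset.sum_le_sum fun p _ ↦ norm_le_norm_sub_add _ _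
  rw [Finset.sum_add_distrib] at h3
  linarith

omit hself in
theorem norm_debiased_sub_average_le {η : ℝ} (hη : 0 < η) {k : ℕ} {p : AugAgent n τmsg}
    (hy : η ≤ weight S k p) : ‖debiased S f α x₀ k p - average S f α x₀ k‖ ≤
      (∑ q, ‖consensusError S f α x₀ k q‖) / η := by
  have hpos := hη.trans_le hy
  have e : debiased S f α x₀ k p - average S f α x₀ k =
      (weight S k p)⁻¹ • consensusError S f α x₀ k p := by
    rw [consensusError, smul_sub, inv_smul_smul₀ hpos.ne', debiased]
  rw [e, norm_smul, norm_inv, Real.norm_of_nonneg hpos.le, inv_mul_eq_div]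
  have h1 := Finset.single_le_sum (f := fun q ↦ ‖consensusError S f α x₀ k q‖)
    (fun q _ ↦ norm_nonneg _) (Finset.mem_univ p)
  exact div_le_div₀ ((norm_nonneg _).trans h1) h1 hη hy

end

/-! ### Descent of the average towards the minimizer -/

section

variable {n d τmsg : ℕ} {G : Digraph (Fin n)} (S : Schedule G 1 τmsg)
  (f : Fin n → Vec d → ℝ) (α : Fin n → ℕ → ℝ) (x₀ : Fin n → Vec d)

/-- One step of the average decreases the squared distance to the minimizer, up to the consensus
error and the square of the step-size. -/
theorem norm_average_succ_sub_sq_le (hself : ∀ i, G.Adj i i) (hn : 0 < n) {m M D Γ a δ : ℝ}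
    {k : ℕ} {xs : Vec d} (hM : 0 ≤ M) (ha : 0 ≤ a) (hα : ∀ i, α i k = a)
    (hmono : ∀ i x y, m * ‖x - y‖ ^ 2 ≤ inner ℝ (gradient (f i) x - gradient (f i) y) (x - y))
    (hlip : ∀ i x y, ‖gradient (f i) x - gradient (f i) y‖ ≤ M * ‖x - y‖)
    (hxs : ∑ i, gradient (f i) xs = 0)
    (hD : ‖average S f α x₀ k - xs‖ ≤ D)
    (hΓ : ∀ i, ‖gradient (f i) (debiased S f α x₀ k (i, 0))‖ ≤ Γ)
    (hδ : ∀ i, ‖debiased S f α x₀ k (i, 0) - average S f α x₀ k‖ ≤ δ) :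
    ‖average S f α x₀ (k + 1) - xs‖ ^ 2 + 2 * a * m * ‖average S f α x₀ k - xs‖ ^ 2 ≤
      ‖average S f α x₀ k - xs‖ ^ 2 + 2 * a * (D * M * δ) + a ^ 2 * Γ ^ 2 := by
  have hn' : (0 : ℝ) < n := by exact_mod_cast hn
  set z := fun i ↦ debiased S f α x₀ k (i, 0) with hz
  set b := average S f α x₀ k with hb
  set w := (n : ℝ)⁻¹ • ∑ i, gradient (f i) (z i) with hw
  have hsucc : average S f α x₀ (k + 1) - xs = (b - xs) - a • w := by
    have hs : ∑ p, gradStep S f α x₀ k p = a • ∑ i, gradient (f i) (z i) := by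
      rw [Finset.smul_sum, ← sum_augAgent_ite (τmsg := τmsg)]
      refine Finset.sum_congr rfl fun p _ ↦ ?_
      obtain ⟨i, r⟩ := p
      simp only [gradStep]
      split_ifs with hr
      · subst hr; rw [hα]
      · rfl
    rw [average_succ S f α x₀ hself, hs, hw, smul_comm]
    abel
  have hwn : ‖w‖ ≤ Γ := by
    rw [hw, norm_smul, norm_inv, Real.norm_of_nonneg hn'.le, inv_mul_le_iff₀ hn']
    refine (norm_sum_le_of_le _ fun i _ ↦ hΓ i).trans_eq ?_
    simp
  have hin : m * ‖b - xs‖ ^ 2 - D * M * δ ≤ inner ℝ (b - xs) w := by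
    have hi : ∀ i, m * ‖b - xs‖ ^ 2 - D * M * δ ≤
        inner ℝ (b - xs) (gradient (f i) (z i) - gradient (f i) xs) := by
      intro i
      -- The first difference is handled by strong monotonicity, the second by the Lipschitz bound
      -- and the consensus error. The gradients at `xs` cancel after summation over `i`.
      have e : gradient (f i) (z i) - gradient (f i) xs =
          (gradient (f i) b - gradient (f i) xs) + (gradient (f i) (z i) - gradient (f i) b) := by
        abel
      have h1 := hmono i b xs
      rw [real_inner_comm] at h1
      have h2 := neg_le_of_abs_le
        (abs_real_inner_le_norm (b - xs) (gradient (f i) (z i) - gradient (f i) b))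
      have h3 : ‖b - xs‖ * ‖gradient (f i) (z i) - gradient (f i) b‖ ≤ D * (M * δ) :=
        mul_le_mul hD ((hlip i _ _).trans (mul_le_mul_of_nonneg_left (hδ i) hM)) (norm_nonneg _)
          ((norm_nonneg _).trans hD)
      rw [e, inner_add_right]
      linarith
    have h4 := Finset.sum_le_sum fun i (_ : i ∈ Finset.univ) ↦ hi i
    rw [← inner_sum, Finset.sum_sub_distrib (f := fun i ↦ gradient (f i) (z i)), hxs, sub_zero,
      Finset.sum_const, Finset.card_univ, Fintype.card_fin, nsmul_eq_mul] at h4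
    rw [hw, inner_smul_right, inv_mul_eq_div, le_div_iff₀ hn', mul_comm]
    exact h4
  rw [hsucc, norm_sub_sq_real, inner_smul_right, norm_smul, Real.norm_of_nonneg ha, mul_pow]
  have h5 := mul_le_mul_of_nonneg_left hin ha
  have h6 := mul_le_mul_of_nonneg_left (pow_le_pow_left₀ (norm_nonneg w) hwn 2) (sq_nonneg a)
  linarith

/-- The summed squared error of a run with constant step-size `a`. -/
theorem sum_norm_average_sub_sq_le (hself : ∀ i, G.Adj i i) (hconn : StronglyConnected G)
    (hn : 0 < n) {m M L Γ a b : ℝ} {xs : Vec d} (hM : 0 ≤ M) (ha : 0 ≤ a)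
    (hα : ∀ i k, α i k = a)
    (hab : a ≤ b * (1 / (maxOutDegree G : ℝ)) ^ (n * (τmsg + 1)))
    (hmono : ∀ i x y, m * ‖x - y‖ ^ 2 ≤ inner ℝ (gradient (f i) x - gradient (f i) y) (x - y))
    (hlip : ∀ i x y, ‖gradient (f i) x - gradient (f i) y‖ ≤ M * ‖x - y‖)
    (hxs : ∑ i, gradient (f i) xs = 0)
    (hstep : ∀ i s z, 0 ≤ s → s ≤ b → ‖z‖ ≤ L → ‖z - s • gradient (f i) z‖ ≤ L)
    (hx₀ : ∀ i, ‖x₀ i‖ ≤ L)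
    (hΓ : ∀ i z, ‖z‖ ≤ L → ‖gradient (f i) z‖ ≤ Γ) (K : ℕ) :
    2 * a * m * ∑ k ∈ Finset.range K, ‖average S f α x₀ k - xs‖ ^ 2 ≤
      ‖average S f α x₀ 0 - xs‖ ^ 2 +
        a * (4 * (L + ‖xs‖) * M * (n * (τmsg + 1) : ℕ) * n * L /
          ((1 / (maxOutDegree G : ℝ)) ^ (n * (τmsg + 1))) ^ 2) +
        K * a ^ 2 * (4 * (L + ‖xs‖) * M * (n * (τmsg + 1) : ℕ) * n * Γ /
          ((1 / (maxOutDegree G : ℝ)) ^ (n * (τmsg + 1))) ^ 2 + Γ ^ 2) := by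
  have hNpos := maxOutDegree_pos hself hn
  set T := n * (τmsg + 1)
  set η := (1 / (maxOutDegree G : ℝ)) ^ T with hη
  have hηpos : 0 < η := by positivity
  have hy := le_weight S hself hconn
  have hcone := norm_numerator_le S f α x₀ hself hηpos hy (fun i k ↦ by rw [hα]; exact ha)
    (fun i k ↦ by rw [hα]; exact hab) hstep hx₀
  have hL : 0 ≤ L := (norm_nonneg _).trans (hx₀ ⟨0, hn⟩)
  have hΓz : ∀ k i, ‖gradient (f i) (debiased S f α x₀ k (i, 0))‖ ≤ Γ := fun k i ↦
    hΓ i _ (norm_debiased_le S f α x₀ (hηpos.trans_le (hy k i)) (hcone k _))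
  set u : ℕ → ℝ := fun k ↦ ∑ p, ‖consensusError S f α x₀ k p‖ with hu
  have hH : ∀ k, ∑ p, ‖gradStepError S f α x₀ k p‖ ≤ 2 * (n * (a * Γ)) := fun k ↦
    (sum_norm_gradStepError_le S f α x₀ hself hn k).trans <| by
      gcongr
      exact sum_norm_gradStep_le S f α x₀ ha (fun i ↦ hα i k) (hΓz k)
  have hsumu := mul_sum_range_le_of_window_contraction (u := u)
    (fun k ↦ Finset.sum_nonneg fun p _ ↦ norm_nonneg _)
    (sum_norm_consensusError_add_le S f α x₀ hself hconn hn hH) K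
  have hinit : ∑ k ∈ Finset.range T, u k ≤ T * (2 * n * L) := by
    refine (Finset.sum_le_sum fun k _ ↦
      sum_norm_consensusError_le S f α x₀ hself hn (hcone k)).trans_eq ?_
    simp
  have hD : ∀ k, ‖average S f α x₀ k - xs‖ ≤ L + ‖xs‖ := fun k ↦
    (norm_sub_le _ _).trans (add_le_add_left (norm_average_le S f α x₀ hself hn (hcone k)) _)
  have hk : ∀ k, 2 * a * m * ‖average S f α x₀ k - xs‖ ^ 2 ≤
      ‖average S f α x₀ k - xs‖ ^ 2 - ‖average S f α x₀ (k + 1) - xs‖ ^ 2 +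
        (2 * a * ((L + ‖xs‖) * M / η) * u k + a ^ 2 * Γ ^ 2) := fun k ↦ by
    have := norm_average_succ_sub_sq_le S f α x₀ hself hn hM ha (fun i ↦ hα i k) hmono hlip hxs
      (hD k) (hΓz k) (fun i ↦ norm_debiased_sub_average_le S f α x₀ hηpos (hy k i))
    have e : 2 * a * ((L + ‖xs‖) * M * (u k / η)) = 2 * a * ((L + ‖xs‖) * M / η) * u k := by ring
    linarith
  have hsum := Finset.sum_le_sum fun k (_ : k ∈ Finset.range K) ↦ hk k
  rw [← Finset.mul_sum, Finset.sum_add_distrib, Finset.sum_range_sub', Finset.sum_add_distrib,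
    ← Finset.mul_sum, Finset.sum_const, Finset.card_range, nsmul_eq_mul] at hsum
  have hsumu' : ∑ k ∈ Finset.range K, u k ≤
      (T * (2 * n * L) + K * (T * (2 * (n * (a * Γ))))) / η := by
    rw [le_div_iff₀ hηpos, mul_comm]
    linarith
  have hfin := mul_le_mul_of_nonneg_left hsumu'
    (show 0 ≤ 2 * a * ((L + ‖xs‖) * M / η) by positivity)
  -- One factor `1 / η` comes from de-biasing, the other from summing the window contraction.
  have e : 2 * a * ((L + ‖xs‖) * M / η) *
      ((T * (2 * n * L) + K * (T * (2 * (n * (a * Γ))))) / η) =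
      a * (4 * (L + ‖xs‖) * M * T * n * L / η ^ 2) +
        K * a ^ 2 * (4 * (L + ‖xs‖) * M * T * n * Γ / η ^ 2) := by
    field_simp
    ring
  have hlast := sq_nonneg ‖average S f α x₀ K - xs‖
  rw [e] at hfin
  linarith

end

/-! ### Choice of the invariant radius and arithmetic of the rates -/

/-- There is a ball that contains given points and is preserved by short gradient steps along
finitely many strongly monotone fields. -/
theorem exists_radius_gradient_step_le {ι E : Type*} [Fintype ι] [Nonempty ι]
    [NormedAddCommGroup E] [InnerProductSpace ℝ E] {v : ι → E → E} {m M : ℝ} (hm : 0 < m)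
    (hM : 0 ≤ M) (hmono : ∀ i x y, m * ‖x - y‖ ^ 2 ≤ inner ℝ (v i x - v i y) (x - y))
    (hlip : ∀ i x y, ‖v i x - v i y‖ ≤ M * ‖x - y‖) (x₀ : ι → E) :
    ∃ L Γ : ℝ, 0 ≤ L ∧ 0 ≤ Γ ∧ (∀ i, ‖x₀ i‖ ≤ L) ∧ (∀ i z, ‖z‖ ≤ L → ‖v i z‖ ≤ Γ) ∧
      (0 < M → ∀ i s z, 0 ≤ s → s ≤ m / (2 * M ^ 2) → ‖z‖ ≤ L → ‖z - s • v i z‖ ≤ L) := by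
  set C := ∑ i, ‖v i 0‖ with hC
  have hC0 : 0 ≤ C := Finset.sum_nonneg fun i _ ↦ norm_nonneg _
  have hgrowth : ∀ i z, ‖v i z‖ ≤ M * ‖z‖ + C := fun i z ↦ by
    have h1 := hlip i z 0
    rw [sub_zero] at h1
    have h2 : ‖v i 0‖ ≤ C := Finset.single_le_sum
      (f := fun i ↦ ‖v i 0‖) (fun i _ ↦ norm_nonneg _) (Finset.mem_univ i)
    have h3 := norm_le_norm_sub_add (v i z) (v i 0)
    linarith
  set c := 2 * C ^ 2 / m + m * C ^ 2 / M ^ 2 with hc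
  have hc0 : 0 ≤ c := by positivity
  set R := ∑ i, ‖x₀ i‖ with hR
  have hR0 : 0 ≤ R := Finset.sum_nonneg fun i _ ↦ norm_nonneg _
  -- `R` covers the initial points. The summand `1` makes `L ^ 2` dominate the bracketed terms, one
  -- for each radius condition.
  set L := R + (1 + (2 / m * c + m / (2 * M ^ 2) * c)) with hL
  have hx₀ : ∀ i, ‖x₀ i‖ ≤ L := fun i ↦ by
    have h1 : ‖x₀ i‖ ≤ R := Finset.single_le_sum
      (f := fun i ↦ ‖x₀ i‖) (fun i _ ↦ norm_nonneg _) (Finset.mem_univ i)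
    have h2 : 0 ≤ 2 / m * c + m / (2 * M ^ 2) * c := by positivity
    linarith
  have hL0 : 0 ≤ L := (norm_nonneg _).trans (hx₀ (Classical.arbitrary ι))
  have hLsq : 2 / m * c + m / (2 * M ^ 2) * c ≤ L ^ 2 := by
    have h2 : 0 ≤ 2 / m * c + m / (2 * M ^ 2) * c := by positivity
    nlinarith
  have hL₁ : c ≤ m / 2 * L ^ 2 := by
    have h1 : 2 / m * c ≤ L ^ 2 := (le_add_of_nonneg_right (by positivity)).trans hLsq
    have h2 := mul_le_mul_of_nonneg_left h1 (show 0 ≤ m / 2 by positivity)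
    have e : m / 2 * (2 / m * c) = c := by field_simp
    rwa [e] at h2
  have hL₂ : m / (2 * M ^ 2) * c ≤ L ^ 2 := (le_add_of_nonneg_left (by positivity)).trans hLsq
  refine ⟨L, M * L + C, hL0, by positivity, hx₀, fun i z hz ↦ (hgrowth i z).trans (by gcongr),
    fun hMpos i s z hs hs' hz ↦ ?_⟩
  exact norm_sub_smul_le_of_strongly_monotone hm hMpos hL₁ hL₂ hL0 hs hs'
    (fun z ↦ by simpa using hmono i z 0) (hgrowth i) hz

/-- The arithmetic that turns a summed bound for the step-size `B / K ^ θ` into a rate. -/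
theorem mean_le_of_const_step {B m θ Y X C₁ C₂ N : ℝ} {K : ℕ} (hB : 0 < B) (hm : 0 < m)
    (hK : 0 < K) (hN : 1 ≤ N) (hX : 0 ≤ X) (hC₁ : 0 ≤ C₁) (hC₂ : 0 ≤ C₂)
    (h : 2 * (B / (K : ℝ) ^ θ) * m * Y ≤
      X + B / (K : ℝ) ^ θ * C₂ + K * (B / (K : ℝ) ^ θ) ^ 2 * C₁) :
    1 / (K : ℝ) * Y ≤ 1 / (K : ℝ) ^ θ * (N * (B ^ 2 * C₁) / (2 * m * B)) +
      1 / (K : ℝ) * (N * (B * C₂) / (2 * m * B)) +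
      1 / (K : ℝ) ^ (1 - θ) * (N * X / (2 * m * B)) := by
  have hK' : (0 : ℝ) < K := by exact_mod_cast hK
  have ht : 0 < (K : ℝ) ^ θ := Real.rpow_pos_of_pos hK' θ
  rw [Real.rpow_sub hK', Real.rpow_one]
  set t := (K : ℝ) ^ θ
  have h1 : 1 / (K : ℝ) * Y = t / (2 * m * B * K) * (2 * (B / t) * m * Y) := by
    field_simp
  have h2 : t / (2 * m * B * K) * (X + B / t * C₂ + K * (B / t) ^ 2 * C₁) =
      1 / t * (1 * (B ^ 2 * C₁) / (2 * m * B)) + 1 / K * (1 * (B * C₂) / (2 * m * B)) +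
        1 / (K / t) * (1 * X / (2 * m * B)) := by
    field_simp
    ring
  rw [h1]
  refine (mul_le_mul_of_nonneg_left h (by positivity)).trans ?_
  rw [h2]
  -- The bound holds with factor `1`; the factor `N ≥ 1` is slack.
  gcongr

end AsyncGradientPush

end

/-! ### Constants uniform in the schedule, and conclusion -/

theorem mainTheorem10 (n d : ℕ) (hn : 0 < n)
    (G : Digraph (Fin n)) (hself : ∀ i, G.Adj i i)
    (hconn : AsyncGradientPush.StronglyConnected G)
    (τmsg : ℕ)
    (f : Fin n → AsyncGradientPush.Vec d → ℝ)
    (μ : Fin n → ℝ) (M : Fin n → NNReal)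
    (hμ : ∀ i, 0 < μ i)
    (hconv : ∀ i, StrongConvexOn Set.univ (μ i) (f i))
    (hdiff : ∀ i, Differentiable ℝ (f i))
    (hlip : ∀ i, LipschitzWith (M i) (gradient (f i)))
    (xstar : AsyncGradientPush.Vec d)
    (hmin : IsMinOn (fun x => ∑ i, f i x) Set.univ xstar)
    (x₀ : Fin n → AsyncGradientPush.Vec d)
    (B : ℝ) (hB : 0 < B) :
    ∃ A₁ A₂ A₃ : ℝ, 0 < A₁ ∧ 0 < A₂ ∧ 0 < A₃ ∧
      ∀ (θ : ℝ), 0 < θ → θ < 1 →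
      ∀ (K : ℕ), 0 < K →
      ∀ (α : Fin n → ℕ → ℝ),
        α = AsyncGradientPush.constStepSize (fun _ => 1) B θ K →
        AsyncGradientPush.StepSizeBound G 1 τmsg (⨅ i, μ i) (⨆ i, (M i : ℝ)) α →
      ∀ (S : AsyncGradientPush.Schedule G 1 τmsg),
        (1 / (K : ℝ)) * ∑ k ∈ Finset.range K,
            ‖AsyncGradientPush.average S f α x₀ k - xstar‖ ^ 2 ≤
          (1 / (K : ℝ) ^ θ) * ((n : ℝ) * (A₁ + A₃) / (2 * (⨅ i, μ i) * B)) +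
          (1 / (K : ℝ)) * ((n : ℝ) * A₂ / (2 * (⨅ i, μ i) * B)) +
          (1 / (K : ℝ) ^ (1 - θ)) *
            ((n : ℝ) * ‖AsyncGradientPush.average S f α x₀ 0 - xstar‖ ^ 2 /
              (2 * (⨅ i, μ i) * B)) := by
  have : Nonempty (Fin n) := ⟨⟨0, hn⟩⟩
  set m := ⨅ i, μ i with hm
  set N := ⨆ i, (M i : ℝ) with hN
  have hmpos : 0 < m := by
    obtain ⟨i, hi⟩ := exists_eq_ciInf_of_finite (f := μ)
    rw [hm, ← hi]
    exact hμ i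
  have hmle : ∀ i, m ≤ μ i := fun i ↦ ciInf_le (Set.finite_range μ).bddBelow i
  have hNle : ∀ i, (M i : ℝ) ≤ N := fun i ↦
    le_ciSup (f := fun i ↦ (M i : ℝ)) (Set.finite_range _).bddAbove i
  have hN0 : 0 ≤ N := (M ⟨0, hn⟩).2.trans (hNle _)
  have hmono : ∀ i x y, m * ‖x - y‖ ^ 2 ≤
      inner ℝ (gradient (f i) x - gradient (f i) y) (x - y) := fun i x y ↦
    (mul_le_mul_of_nonneg_right (hmle i) (sq_nonneg _)).trans
      (AsyncGradientPush.strongConvexOn_gradient_inner_ge (hconv i) (hdiff i) x y)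
  have hgrad : ∀ i x y, ‖gradient (f i) x - gradient (f i) y‖ ≤ N * ‖x - y‖ := fun i x y ↦
    ((hlip i).norm_sub_le x y).trans (mul_le_mul_of_nonneg_right (hNle i) (norm_nonneg _))
  obtain ⟨L, Γ, hL0, hΓ0, hx₀, hΓ, hstep⟩ :=
    AsyncGradientPush.exists_radius_gradient_step_le hmpos hN0 hmono hgrad x₀
  set T := n * (τmsg + 1) with hT
  set η := (1 / (AsyncGradientPush.maxOutDegree G : ℝ)) ^ T with hη
  set C₁ := 4 * (L + ‖xstar‖) * N * (T : ℕ) * n * Γ / η ^ 2 + Γ ^ 2 with hC₁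
  set C₂ := 4 * (L + ‖xstar‖) * N * (T : ℕ) * n * L / η ^ 2 with hC₂
  have hC₁0 : 0 ≤ C₁ := by positivity
  have hC₂0 : 0 ≤ C₂ := by positivity
  -- `C₁` collects the terms of order `K a²` and `C₂` those of order `a`; the added `1`s only ensure
  -- positivity.
  refine ⟨B ^ 2 * C₁ + 1, B * C₂ + 1, 1, by positivity, by positivity, one_pos, ?_⟩
  intro θ _ _ K hK α hα hbound S
  have hK' : (0 : ℝ) < K := by exact_mod_cast hK
  have ha : 0 < B / (K : ℝ) ^ θ := div_pos hB (Real.rpow_pos_of_pos hK' θ)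
  have hαa : ∀ i k, α i k = B / (K : ℝ) ^ θ := fun i k ↦ by
    rw [hα, AsyncGradientPush.constStepSize, one_mul]
  have hab : B / (K : ℝ) ^ θ ≤ m / (2 * N ^ 2) * η := by
    rw [← hαa ⟨0, hn⟩ 0]
    exact hbound ⟨0, hn⟩ 0
  -- If `N = 0`, division by zero turns the step-size bound into `B / K ^ θ ≤ 0`, which is
  -- impossible.
  have hNpos : 0 < N := by
    rcases hN0.eq_or_lt with h | h
    · rw [← h] at hab
      simp only [ne_eq, OfNat.ofNat_ne_zero, not_false_eq_true, zero_pow, mul_zero, div_zero,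
        zero_mul] at hab
      exact absurd ha (not_lt.2 hab)
    · exact h
  have hmain := AsyncGradientPush.sum_norm_average_sub_sq_le S f α x₀ hself hconn hn hN0 ha.le
    hαa hab hmono hgrad
    (AsyncGradientPush.sum_gradient_eq_zero_of_isMinOn hdiff hmin) (hstep hNpos) hx₀ hΓ K
  have hfin := AsyncGradientPush.mean_le_of_const_step (N := (n : ℝ)) hB hmpos hK
    (by exact_mod_cast hn) (sq_nonneg _) hC₁0 hC₂0 hmain
  refine hfin.trans ?_
  gcongr
  · linarith
  · linarith
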